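/- For $m,n\ge 0$ let $\mathbb{R}^{m,n}$ be $\mathbb{R}^{m+n}$ with the quadratic form $-v_1^2-\dots-v_m^2+v_{m+1}^2+\dots+v_{m+n}^2$, let $O(m,n)$ be its group of linear isometries and $SO_\circ(m,n)$ the identity component of $O(m,n)$. Let $\mathrm{SL}(2,\mathbb{R})\times\mathrm{SL}(2,\mathbb{R})$ act isometrically on $(M(2,\mathbb{R}),-\det)$, a quadratic space of signature $(2,2)$ (two negative, two positive directions), by $(A,B)\cdot X=AXB^{-1}$, and on $\mathbb{R}^{2,3}\cong M(2,\mathbb{R})\oplus\mathbb{R}$, with the form $(X,z)\mapsto -\det X+z^2$, by $(A,B)\cdot(X,z)=(AXB^{-1},z)$. Let $\mathbb{E}\mathrm{in}^{1,2}$ be the set of isotropic lines of $\mathbb{R}^{2,3}$, with the induced action. Let $\varphi:\mathrm{SL}(2,\mathbb{R})\to\mathrm{SL}(2,\mathbb{R})$ be an automorphism which is not of the form $g\mapsto hgh^{-1}$ with $h\in\mathrm{SL}(2,\mathbb{R})$, and suppose that $G=\mathrm{graph}(\varphi)=\{(g,\varphi(g)):g\in\mathrm{SL}(2,\mathbb{R})\}$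 has a $2$-dimensional orbit in $\mathbb{E}\mathrm{in}^{1,2}$. Then there is exactly one $G$-invariant spacelike line in $(M(2,\mathbb{R}),-\det)$, that is, exactly one $G$-invariant one-dimensional linear subspace on which $-\det$ is positive definite. Moreover, the action of $G$ on $\mathbb{R}^{2,3}$ is conjugate to that of $SO_\circ(2,1)$ acting trivially on a positive definite plane: there is a linear isometry $T$ from $M(2,\mathbb{R})\oplus\mathbb{R}$ onto $\mathbb{R}^{2,3}=\mathbb{R}^{2,1}\oplus\mathbb{R}^{0,2}$ which carries the group of transformations of $M(2,\mathbb{R})\oplus\mathbb{R}$ given by $G$ onto $\{h\oplus\mathrm{id}_{\mathbb{R}^{0,2}}:h\in SO_\circ(2,1)\}$. -/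

import Mathlib

open scoped MatrixGroups LinearAlgebra.Projectivization Topology

noncomputable section

namespace EinsteinUniverse

/-- The vector space `M(2,ℝ)`. -/
abbrev Mat2 : Type := Matrix (Fin 2) (Fin 2) ℝ

/-- The quadratic form `-det`, of signature `(2,2)`, on `M(2,ℝ)`. -/
def negDet : QuadraticForm ℝ Mat2 :=
  QuadraticMap.linMulLin (Matrix.entryLinearMap ℝ ℝ 0 1) (Matrix.entryLinearMap ℝ ℝ 1 0) -
    QuadraticMap.linMulLin (Matrix.entryLinearMap ℝ ℝ 0 0) (Matrix.entryLinearMap ℝ ℝ 1 1)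

theorem negDet_apply (X : Mat2) : negDet X = -X.det := by
  simp [negDet, Matrix.det_fin_two]

/-- The isometric action of `SL(2,ℝ) × SL(2,ℝ)` on `(M(2,ℝ), -det)`: `(A, B) · X = A X B⁻¹`. -/
def actMat : Representation ℝ (SL(2, ℝ) × SL(2, ℝ)) Mat2 where
  toFun g := LinearMap.mulLeft ℝ (g.1 : Mat2) ∘ₗ LinearMap.mulRight ℝ ((g.2⁻¹ : SL(2, ℝ)) : Mat2)
  map_one' := by ext; simp
  map_mul' g h := by
    refine LinearMap.ext fun X => ?_
    simp only [Prod.fst_mul, Prod.snd_mul, mul_inv_rev, Matrix.SpecialLinearGroup.coe_mul,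
      LinearMap.comp_apply, Module.End.mul_apply, LinearMap.mulLeft_apply,
      LinearMap.mulRight_apply, Matrix.mul_assoc]

theorem actMat_apply (g : SL(2, ℝ) × SL(2, ℝ)) (X : Mat2) :
    actMat g X = (g.1 : Mat2) * X * ((g.2⁻¹ : SL(2, ℝ)) : Mat2) := by
  simp [actMat, Matrix.mul_assoc]

/-- The underlying space `M(2,ℝ) ⊕ ℝ` of the model of `ℝ^{2,3}`. -/
abbrev E23 : Type := Mat2 × ℝ

/-- The quadratic form `(X, z) ↦ -det X + z²`, of signature `(2,3)`. -/
def q23 : QuadraticForm ℝ E23 := QuadraticMap.prod negDet QuadraticMap.sq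

theorem q23_apply (v : E23) : q23 v = -v.1.det + v.2 * v.2 := by
  simp [q23, negDet_apply]

/-- The isometric action of `SL(2,ℝ) × SL(2,ℝ)` on `ℝ^{2,3} = M(2,ℝ) ⊕ ℝ`, trivial on the
spacelike line `0 ⊕ ℝ`: `(A, B) · (X, z) = (A X B⁻¹, z)`. -/
def actE : Representation ℝ (SL(2, ℝ) × SL(2, ℝ)) E23 :=
  actMat.prod (Representation.trivial ℝ (SL(2, ℝ) × SL(2, ℝ)) ℝ)

theorem actE_apply (g : SL(2, ℝ) × SL(2, ℝ)) (v : E23) :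
    actE g v = ((g.1 : Mat2) * v.1 * ((g.2⁻¹ : SL(2, ℝ)) : Mat2), v.2) := by
  rw [← actMat_apply]; rfl

/-- The actions are by linear isometries. -/
theorem q23_actE (g : SL(2, ℝ) × SL(2, ℝ)) (v : E23) : q23 (actE g v) = q23 v := by
  rw [actE_apply, q23_apply, q23_apply]
  simp only [Matrix.det_mul, Matrix.SpecialLinearGroup.det_coe, one_mul, mul_one]

/-- The Einstein universe `Ein^{1,2}`: the projectivized nullcone of `ℝ^{2,3}`. -/
def Ein12 : Set (ℙ ℝ E23) := {x | q23 x.rep = 0}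

/-- The tangent space at `x` of the orbit of `x` in `ℙ(ℝ^{2,3})` under a Lie subgroup `G` of
`SL(2,ℝ) × SL(2,ℝ)`. With `T_x ℙ(V)` identified with `V ⧸ x` by the choice of the vector `x.rep`
spanning the line `x`, it consists of the velocities at `t = 0` of the curves `t ↦ c(t) · x`,
where `c` runs through the one-parameter subgroups of `G` (its Lie algebra). -/
def orbitTangentSpace (G : Subgroup (SL(2, ℝ) × SL(2, ℝ))) (x : ℙ ℝ E23) :
    Submodule ℝ (E23 ⧸ x.submodule) :=
  Submodule.span ℝ {u | ∃ (c : Multiplicative ℝ →* SL(2, ℝ) × SL(2, ℝ)) (w : E23),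
    Continuous c ∧ (∀ t, c t ∈ G) ∧
    Filter.Tendsto (fun t : ℝ => t⁻¹ • (actE (c (Multiplicative.ofAdd t)) x.rep - x.rep))
      (𝓝[≠] 0) (𝓝 w) ∧
    u = x.submodule.mkQ w}

/-- The dimension of the `G`-orbit of `x`. -/
def orbitDim (G : Subgroup (SL(2, ℝ) × SL(2, ℝ))) (x : ℙ ℝ E23) : ℕ :=
  Module.finrank ℝ (orbitTangentSpace G x)

/-- `L` is a spacelike line of the quadratic space `(V, q)`: a one-dimensional linear subspace on
which `q` is positive definite. -/
def IsSpacelikeLine {V : Type*} [AddCommGroup V] [Module ℝ V] (q : QuadraticForm ℝ V)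
    (L : Submodule ℝ V) : Prop :=
  Module.finrank ℝ L = 1 ∧ ∀ v ∈ L, v ≠ 0 → 0 < q v

/-- `ℝ^{m,n}`: the form `-v₁² - ⋯ - v_m² + v_{m+1}² + ⋯ + v_{m+n}²` on `ℝ^{m+n}`. -/
def stdForm (m n : ℕ) : QuadraticForm ℝ (Fin (m + n) → ℝ) :=
  QuadraticMap.weightedSumSquares ℝ (fun i : Fin (m + n) => if (i : ℕ) < m then (-1 : ℝ) else 1)

/-- `O(m,n)`: the group of linear isometries of `ℝ^{m,n}`. -/
def indefO (m n : ℕ) : Subgroup (GL (Fin (m + n)) ℝ) where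
  carrier := {g | ∀ v, stdForm m n ((g : Matrix (Fin (m + n)) (Fin (m + n)) ℝ).mulVec v) =
    stdForm m n v}
  one_mem' v := by simp
  mul_mem' {g h} hg hh v := by
    rw [Units.val_mul, ← Matrix.mulVec_mulVec, hg, hh]
  inv_mem' {g} hg v := by
    rw [← hg, Matrix.mulVec_mulVec, ← Units.val_mul, mul_inv_cancel, Units.val_one,
      Matrix.one_mulVec]

/-- `SO_∘(m,n)`: the identity component of `O(m,n)`. -/
def indefSO0 (m n : ℕ) : Subgroup (GL (Fin (m + n)) ℝ) :=
  (Subgroup.connectedComponentOfOne (indefO m n)).map (indefO m n).subtype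

/-- The coordinates of `ℝ^{2,3}` split as the first three (signs `-,-,+`) and the last two
(signs `+,+`). -/
def splitIndex : Fin (2 + 1) ⊕ Fin 2 ≃ Fin (2 + 3) := finSumFinEquiv (m := 2 + 1) (n := 2)

/-- The endomorphism of `ℝ⁵` given by the block matrix `diag(h, 1, 1)`: it acts by `h` on the first
three coordinates and trivially on the plane of the last two. -/
def blockEnd (h : GL (Fin (2 + 1)) ℝ) : Module.End ℝ (Fin (2 + 3) → ℝ) :=
  Matrix.toLin' (Matrix.reindex splitIndex splitIndex
    (Matrix.fromBlocks (h : Matrix (Fin (2 + 1)) (Fin (2 + 1)) ℝ) 0 0 1))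

/-- `SO_∘(2,1)` as a group of transformations of `ℝ^{2,3}`, with coordinates of signs
`(-,-,+,+,+)`: it acts in the standard way on `ℝ^{2,1}` (the first three coordinates) and trivially
on the positive definite plane of the last two coordinates. -/
def SO21in23 : Set (Module.End ℝ (Fin (2 + 3) → ℝ)) :=
  blockEnd '' (indefSO0 2 1 : Set (GL (Fin (2 + 1)) ℝ))

end EinsteinUniverse

end

/-! Every abstract automorphism of SL(2,ℝ) is conjugation by some P in GL(2,ℝ) (`exists_eq_glConj`).
Dividing P by the square root of |det P| makes its determinant ±1, and +1 would make φ inner. So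
φ(g) = h g k with k = h⁻¹ and det h = -1.

Right multiplication by k then carries conjugation Y ↦ gYg⁻¹ to the action of G, and -det(Yk) = det
Y. Hence G acts on (M(2,ℝ), -det) as SL(2,ℝ) acts by conjugation on (M(2,ℝ), det), which is the
orthogonal sum of the positive line ℝ·1 and the traceless matrices, of signature (2,1). The
invariant line is ℝk. It is unique because an invertible matrix that conjugation only rescales is
scalar (`eq_smul_one_of_conj_eq_smul`). The image of the adjoint representation is SO_∘(2,1)
(`mem_indefSO0_iff`), and ℝk together with the extra summand ℝ is the fixed definite plane.

Continuity of φ is not assumed. Unipotents are recognized algebraically, as elements conjugate to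
their fourth power. On a unipotent subgroup φ becomes an additive map of ℝ that preserves squares,
hence order, so it is linear. -/

noncomputable section

namespace EinsteinUniverse

/-! ### Unipotent generators of SL(2,ℝ) -/

/-- The upper unipotent matrix with entry `t`. -/
def upperUni (t : ℝ) : SL(2, ℝ) := ⟨!![1, t; 0, 1], by simp [Matrix.det_fin_two]⟩

/-- The lower unipotent matrix with entry `t`. -/
def lowerUni (t : ℝ) : SL(2, ℝ) := ⟨!![1, 0; t, 1], by simp [Matrix.det_fin_two]⟩

theorem coe_upperUni (t : ℝ) : (upperUni t : Mat2) = !![1, t; 0, 1] := rfl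

theorem coe_lowerUni (t : ℝ) : (lowerUni t : Mat2) = !![1, 0; t, 1] := rfl

theorem sl_ext {A B : SL(2, ℝ)} (h : (A : Mat2) = B) : A = B := Subtype.ext h

theorem upperUni_add (s t : ℝ) : upperUni (s + t) = upperUni s * upperUni t := by
  apply sl_ext
  simp [coe_upperUni, add_comm]

theorem lowerUni_add (s t : ℝ) : lowerUni (s + t) = lowerUni s * lowerUni t := by
  apply sl_ext
  simp [coe_lowerUni]

theorem upperUni_zero : upperUni 0 = 1 := by
  apply sl_ext
  simp [coe_upperUni, Matrix.one_fin_two]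

theorem lowerUni_zero : lowerUni 0 = 1 := by
  apply sl_ext
  simp [coe_lowerUni, Matrix.one_fin_two]

theorem upperUni_injective : Function.Injective upperUni := fun s t h => by
  simpa [coe_upperUni] using congrFun (congrFun (congrArg Subtype.val h) 0) 1

theorem upperUni_pow (t : ℝ) (n : ℕ) : upperUni t ^ n = upperUni (n * t) := by
  induction n with
  | zero => simp [upperUni_zero]
  | succ n ih => rw [pow_succ, ih, ← upperUni_add]; push_cast; ring_nf

theorem lowerUni_pow (t : ℝ) (n : ℕ) : lowerUni t ^ n = lowerUni (n * t) := by
  induction n with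
  | zero => simp [lowerUni_zero]
  | succ n ih => rw [pow_succ, ih, ← lowerUni_add]; push_cast; ring_nf

/-- The diagonal matrix `diag(t, 1/t)`. -/
def diagSL (t : ℝ) (ht : t ≠ 0) : SL(2, ℝ) := ⟨!![t, 0; 0, t⁻¹], by simp [Matrix.det_fin_two, ht]⟩

theorem coe_diagSL (t : ℝ) (ht : t ≠ 0) : (diagSL t ht : Mat2) = !![t, 0; 0, t⁻¹] := rfl

theorem diagSL_mul_upperUni (t : ℝ) (ht : t ≠ 0) (s : ℝ) :
    diagSL t ht * upperUni s = upperUni (t ^ 2 * s) * diagSL t ht := by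
  apply sl_ext
  simp only [Matrix.SpecialLinearGroup.coe_mul, coe_diagSL, coe_upperUni]
  ext i j
  fin_cases i <;> fin_cases j <;> simp
  field_simp

theorem lowerUni_mul_diagSL (t : ℝ) (ht : t ≠ 0) (s : ℝ) :
    lowerUni s * diagSL t ht = diagSL t ht * lowerUni (t ^ 2 * s) := by
  apply sl_ext
  simp only [Matrix.SpecialLinearGroup.coe_mul, coe_diagSL, coe_lowerUni]
  ext i j
  fin_cases i <;> fin_cases j <;> simp
  field_simp

/-- The upper and lower unipotent matrices generate `SL(2,ℝ)`. -/
theorem eq_top_of_unipotent_mem (H : Subgroup SL(2, ℝ)) (hu : ∀ t, upperUni t ∈ H)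
    (hl : ∀ t, lowerUni t ∈ H) : H = ⊤ := by
  -- In a product upper·lower·upper the lower parameter is the (1,0) entry; the two diagonal entries
  -- then determine the upper parameters.
  have key : ∀ g : SL(2, ℝ), (g : Mat2) 1 0 ≠ 0 → g ∈ H := by
    intro g hc
    have hd := g.det_coe
    rw [Matrix.det_fin_two] at hd
    have : g = upperUni (((g : Mat2) 0 0 - 1) / (g : Mat2) 1 0) * lowerUni ((g : Mat2) 1 0) *
        upperUni (((g : Mat2) 1 1 - 1) / (g : Mat2) 1 0) := by
      apply sl_ext
      simp only [Matrix.SpecialLinearGroup.coe_mul, coe_upperUni, coe_lowerUni]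
      ext i j
      fin_cases i <;> fin_cases j <;> simp
      · field_simp; ring
      · field_simp; linear_combination -hd
      · field_simp; ring
    rw [this]
    exact H.mul_mem (H.mul_mem (hu _) (hl _)) (hu _)
  rw [eq_top_iff]
  intro g _
  by_cases hc : (g : Mat2) 1 0 = 0
  · have hd := g.det_coe
    rw [Matrix.det_fin_two, hc, mul_zero, sub_zero] at hd
    have h1 : g * lowerUni 1 ∈ H := by
      apply key
      simp [coe_lowerUni, Matrix.mul_apply, hc]
      rintro h
      simp [h] at hd
    exact (H.mul_mem_cancel_right (hl 1)).mp h1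
  · exact key g hc

/-! ### Automorphisms preserve unipotents -/

/-- Cayley–Hamilton with determinant 1: every power of g reduces to a combination of g and 1. -/
theorem sq_eq_trace_smul_sub_one (g : SL(2, ℝ)) :
    (g : Mat2) * g = (g : Mat2).trace • (g : Mat2) - 1 := by
  have hd := g.det_coe
  rw [Matrix.det_fin_two] at hd
  ext i j
  fin_cases i <;> fin_cases j <;>
    simp [Matrix.mul_apply, Matrix.trace_fin_two, Fin.sum_univ_two]
  · linear_combination -hd
  · ring
  · ring
  · linear_combination -hd

theorem pow_four_eq (g : SL(2, ℝ)) {t : ℝ} (ht : (g : Mat2).trace = t) :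
    (g : Mat2) ^ 4 = (t ^ 3 - 2 * t) • (g : Mat2) - (t ^ 2 - 1) • (1 : Mat2) := by
  have h2 := sq_eq_trace_smul_sub_one g
  rw [ht] at h2
  rw [show (4 : ℕ) = 2 + 2 from rfl, pow_add, pow_two, h2]
  simp only [sub_mul, mul_sub, smul_mul_assoc, mul_smul_comm, h2, mul_one, one_mul]
  module

/-- A matrix conjugate to its fourth power is unipotent or of order dividing `15`. -/
theorem trace_eq_two_of_isConj_pow_four {g : SL(2, ℝ)} (h : IsConj g (g ^ 4))
    (h15 : g ^ 15 ≠ 1) : (g : Mat2).trace = 2 := by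
  obtain ⟨c, hc⟩ := isConj_iff.mp h
  set t := (g : Mat2).trace with ht
  have h2 := sq_eq_trace_smul_sub_one g
  rw [← ht] at h2
  have h4 := pow_four_eq g ht.symm
  have htr : t = ((g : Mat2) ^ 4).trace := by
    rw [← Matrix.SpecialLinearGroup.coe_pow, ← hc, Matrix.SpecialLinearGroup.coe_mul,
      Matrix.trace_mul_comm, ← Matrix.SpecialLinearGroup.coe_mul]
    simp [ht]
  rw [h4, Matrix.trace_sub, Matrix.trace_smul, Matrix.trace_smul, ← ht, Matrix.trace_one] at htr
  simp only [smul_eq_mul, Fintype.card_fin, Nat.cast_ofNat] at htr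
  -- The root t = -1 gives elements of order 3 and the roots of t² + t - 1 elements of order 5,
  -- whence the exponent 15.
  have hfac : (t - 2) * ((t + 1) * (t ^ 2 + t - 1)) = 0 := by linear_combination -htr
  rcases mul_eq_zero.mp hfac with h | h
  · linarith
  exfalso
  apply h15
  rcases mul_eq_zero.mp h with h | h
  · have h3 : g ^ 3 = 1 := by
      apply sl_ext
      have ht1 : t = -1 := by linarith
      rw [ht1] at h2
      rw [Matrix.SpecialLinearGroup.coe_pow, pow_succ, pow_two, h2, sub_mul, smul_mul_assoc, h2,
        Matrix.SpecialLinearGroup.coe_one, one_mul]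
      module
    rw [show 15 = 3 * 5 from rfl, pow_mul, h3, one_pow]
  · have h5 : g ^ 5 = 1 := by
      apply sl_ext
      rw [Matrix.SpecialLinearGroup.coe_pow, pow_succ, h4, sub_mul, smul_mul_assoc,
        smul_mul_assoc, h2, Matrix.SpecialLinearGroup.coe_one, one_mul]
      have h3 : t ^ 3 - 2 * t = -1 := by linear_combination (t - 1) * h
      rw [h3, show t ^ 2 - 1 = -t by linarith]
      module
    rw [show 15 = 5 * 3 from rfl, pow_mul, h5, one_pow]

/-- Conjugation by diag(2, 1/2) multiplies the parameter by 4, so a unipotent is conjugate to its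
fourth power. This and infinite order (for t ≠ 0) survive any automorphism. -/
theorem trace_map_upperUni (φ : MulAut SL(2, ℝ)) (t : ℝ) :
    (φ (upperUni t) : Mat2).trace = 2 := by
  by_cases ht : t = 0
  · simp [ht, upperUni_zero]
  apply trace_eq_two_of_isConj_pow_four
  · rw [← map_pow]
    refine φ.toMonoidHom.map_isConj (isConj_iff.mpr ⟨diagSL 2 two_ne_zero, ?_⟩)
    rw [diagSL_mul_upperUni, mul_inv_cancel_right, upperUni_pow]
    norm_num
  · rw [← map_pow, Ne, map_eq_one_iff φ φ.injective, upperUni_pow, ← upperUni_zero,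
      upperUni_injective.eq_iff]
    simpa using ht

theorem trace_map_lowerUni (φ : MulAut SL(2, ℝ)) (t : ℝ) :
    (φ (lowerUni t) : Mat2).trace = 2 := by
  by_cases ht : t = 0
  · simp [ht, lowerUni_zero]
  apply trace_eq_two_of_isConj_pow_four
  · rw [← map_pow]
    refine φ.toMonoidHom.map_isConj (isConj_iff.mpr ⟨(diagSL 2 two_ne_zero)⁻¹, ?_⟩)
    rw [mul_assoc, inv_inv, lowerUni_mul_diagSL, inv_mul_cancel_left, lowerUni_pow]
    norm_num
  · rw [← map_pow, Ne, map_eq_one_iff φ φ.injective, lowerUni_pow, ← lowerUni_zero]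
    intro h
    have := congrFun (congrFun (congrArg Subtype.val h) 1) 0
    simp [coe_lowerUni] at this
    exact ht this

/-! ### Classification of the automorphisms of SL(2,ℝ) -/

/-- Conjugation by an invertible matrix, as an endomorphism of `SL(2,ℝ)`. -/
def glConjHom (P : GL (Fin 2) ℝ) : SL(2, ℝ) →* SL(2, ℝ) where
  toFun g := ⟨(P : Mat2) * g * ((P⁻¹ : GL (Fin 2) ℝ) : Mat2), by
    rw [Matrix.det_mul_right_comm, ← Units.val_mul, mul_inv_cancel, Units.val_one, one_mul,
      Matrix.SpecialLinearGroup.det_coe]⟩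
  map_one' := by apply sl_ext; simp
  map_mul' g h := by
    apply sl_ext
    change (P : Mat2) * ((g : Mat2) * h) * ((P⁻¹ : GL (Fin 2) ℝ) : Mat2) =
      ((P : Mat2) * g * ((P⁻¹ : GL (Fin 2) ℝ) : Mat2)) *
        ((P : Mat2) * h * ((P⁻¹ : GL (Fin 2) ℝ) : Mat2))
    simp only [mul_assoc, Units.inv_mul_cancel_left]

theorem coe_glConjHom (P : GL (Fin 2) ℝ) (g : SL(2, ℝ)) :
    (glConjHom P g : Mat2) = (P : Mat2) * g * ((P⁻¹ : GL (Fin 2) ℝ) : Mat2) := rfl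

theorem glConjHom_mul_apply (P Q : GL (Fin 2) ℝ) (g : SL(2, ℝ)) :
    glConjHom (P * Q) g = glConjHom P (glConjHom Q g) := by
  apply sl_ext
  simp only [coe_glConjHom, mul_inv_rev, Units.val_mul, mul_assoc]

theorem glConjHom_one_apply (g : SL(2, ℝ)) : glConjHom 1 g = g := by
  apply sl_ext
  simp [coe_glConjHom]

/-- Conjugation by an invertible matrix, as an automorphism of `SL(2,ℝ)`. -/
def glConj (P : GL (Fin 2) ℝ) : MulAut SL(2, ℝ) :=
  MulEquiv.ofBijective (glConjHom P) ⟨fun g h hgh => by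
      have := congrArg (glConjHom P⁻¹) hgh
      rwa [← glConjHom_mul_apply, ← glConjHom_mul_apply, inv_mul_cancel, glConjHom_one_apply,
        glConjHom_one_apply] at this,
    fun g => ⟨glConjHom P⁻¹ g, by
      rw [← glConjHom_mul_apply, mul_inv_cancel, glConjHom_one_apply]⟩⟩

theorem glConj_apply (P : GL (Fin 2) ℝ) (g : SL(2, ℝ)) : glConj P g = glConjHom P g := rfl

theorem coe_glConj (P : GL (Fin 2) ℝ) (g : SL(2, ℝ)) :
    (glConj P g : Mat2) = (P : Mat2) * g * ((P⁻¹ : GL (Fin 2) ℝ) : Mat2) := rfl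

/-- Clears the inverse, so that conjugacy can be checked entry by entry. -/
theorem glConj_inv_apply_eq_iff (P : GL (Fin 2) ℝ) (g h : SL(2, ℝ)) :
    glConj P⁻¹ g = h ↔ (g : Mat2) * P = P * h := by
  have : glConj P⁻¹ g = h ↔ (glConj P⁻¹ g : Mat2) = h := ⟨congrArg Subtype.val, sl_ext⟩
  rw [this, coe_glConj, inv_inv, mul_assoc, Units.inv_mul_eq_iff_eq_mul]

/-- A nontrivial unipotent matrix is conjugate to the standard one. -/
theorem exists_glConj_eq_upperUni_one {g : SL(2, ℝ)} (ht : (g : Mat2).trace = 2) (h1 : g ≠ 1) :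
    ∃ P : GL (Fin 2) ℝ, glConj P g = upperUni 1 := by
  have hd := g.det_coe
  rw [Matrix.det_fin_two] at hd
  rw [Matrix.trace_fin_two] at ht
  by_cases hc : (g : Mat2) 1 0 = 0
  · rw [hc, mul_zero, sub_zero] at hd
    have ha : (g : Mat2) 0 0 = 1 := by nlinarith
    have hdd : (g : Mat2) 1 1 = 1 := by linarith
    have hb : (g : Mat2) 0 1 ≠ 0 := by
      intro hb
      apply h1
      apply sl_ext
      ext i j
      fin_cases i <;> fin_cases j <;> simp [ha, hb, hc, hdd]
    -- The columns are (g - 1)e and e for a basis vector e not fixed by g: the second one here, the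
    -- first one in the other case.
    refine ⟨(Matrix.GeneralLinearGroup.mkOfDetNeZero !![(g : Mat2) 0 1, 0; 0, 1] (by
      simpa [Matrix.det_fin_two] using hb))⁻¹, ?_⟩
    rw [glConj_inv_apply_eq_iff]
    ext i j
    fin_cases i <;> fin_cases j <;>
      simp [Matrix.GeneralLinearGroup.mkOfDetNeZero, coe_upperUni, Matrix.mul_apply, ha, hc, hdd]
  · refine ⟨(Matrix.GeneralLinearGroup.mkOfDetNeZero
      !![(g : Mat2) 0 0 - 1, 1; (g : Mat2) 1 0, 0] (by
      simpa [Matrix.det_fin_two] using hc))⁻¹, ?_⟩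
    rw [glConj_inv_apply_eq_iff]
    ext i j
    fin_cases i <;> fin_cases j <;>
      simp [Matrix.GeneralLinearGroup.mkOfDetNeZero, coe_upperUni, Matrix.mul_apply]
    · linear_combination (g : Mat2) 0 0 * ht - hd
    · linear_combination (g : Mat2) 1 0 * ht

/-- An automorphism fixing two opposite unipotent elements is trivial. -/
theorem eq_one_of_fix (χ : MulAut SL(2, ℝ)) (hu : χ (upperUni 1) = upperUni 1)
    (hl : χ (lowerUni (-1)) = lowerUni (-1)) : χ = 1 := by
  -- The image commutes with `upperUni 1` and has trace 2, so it is again upper unipotent.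
  have hcomm : ∀ t, ∃ s, χ (upperUni t) = upperUni s := by
    intro t
    have htr := trace_map_upperUni χ t
    have hc : χ (upperUni t) * upperUni 1 = upperUni 1 * χ (upperUni t) := by
      conv_lhs => rw [← hu]
      conv_rhs => rw [← hu]
      rw [← map_mul, ← map_mul, ← upperUni_add, ← upperUni_add, add_comm]
    have hc' := congrArg Subtype.val hc
    simp only [Matrix.SpecialLinearGroup.coe_mul, coe_upperUni] at hc'
    rw [Matrix.trace_fin_two] at htr
    have e00 := congrFun (congrFun hc' 0) 0
    have e01 := congrFun (congrFun hc' 0) 1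
    simp [Matrix.mul_apply] at e00 e01
    refine ⟨(χ (upperUni t) : Mat2) 0 1, ?_⟩
    apply sl_ext
    ext i j
    fin_cases i <;> fin_cases j <;> simp [coe_upperUni]
    · linarith
    · exact e00
    · linarith
  choose σ hσ using hcomm
  have hσ1 : σ 1 = 1 := upperUni_injective ((hσ 1).symm.trans hu)
  have hadd : ∀ s t, σ (s + t) = σ s + σ t := fun s t => upperUni_injective <| by
    rw [← hσ, upperUni_add, map_mul, hσ, hσ, upperUni_add]
  let f : ℝ →+ ℝ := AddMonoidHom.mk' σ hadd
  have hf : ∀ t, σ t = f t := fun _ => rfl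
  -- Applying χ to the diagonal conjugation relation shows that σ(t²) is itself a square. An
  -- additive σ is then monotone, and σ(1) = 1 makes it the identity.
  have hsq : ∀ t, t ≠ 0 → 0 ≤ σ (t ^ 2) := by
    intro t ht
    have h := congrArg χ (diagSL_mul_upperUni t ht 1)
    rw [map_mul, map_mul, hu, mul_one, hσ] at h
    set D := χ (diagSL t ht)
    have h' := congrArg Subtype.val h
    simp only [Matrix.SpecialLinearGroup.coe_mul, coe_upperUni] at h'
    have hd := D.det_coe
    rw [Matrix.det_fin_two] at hd
    have e01 := congrFun (congrFun h' 0) 1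
    have e11 := congrFun (congrFun h' 1) 1
    simp [Matrix.mul_apply] at e01 e11
    rw [e11] at hd
    have : σ (t ^ 2) = (D : Mat2) 0 0 ^ 2 := by
      linear_combination -σ (t ^ 2) * hd - (D : Mat2) 0 0 * e01
    rw [this]
    positivity
  have hnonneg : ∀ t, 0 ≤ t → 0 ≤ f t := by
    intro t ht
    rcases ht.eq_or_lt with rfl | ht
    · simp
    · have := hsq (√t) (Real.sqrt_pos.mpr ht).ne'
      rwa [Real.sq_sqrt ht.le] at this
  have hmono : Monotone f := fun s t hst => by
    have := hnonneg (t - s) (sub_nonneg.mpr hst)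
    rw [map_sub] at this
    linarith
  have hq : ∀ q : ℚ, f q = q := fun q => by
    have := map_rat_smul f q (1 : ℝ)
    rw [← hf 1, hσ1] at this
    simpa [Rat.smul_def] using this
  have hid : ∀ t, f t = t := by
    intro t
    apply le_antisymm
    · by_contra! h
      obtain ⟨q, h1, h2⟩ := exists_rat_btwn h
      have := hmono h1.le
      rw [hq] at this
      linarith
    · by_contra! h
      obtain ⟨q, h1, h2⟩ := exists_rat_btwn h
      have := hmono h2.le
      rw [hq] at this
      linarith
  have hup : ∀ t, χ (upperUni t) = upperUni t := fun t => by rw [hσ, hf, hid]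
  -- The Weyl element is a word in the two fixed elements, and it conjugates upper unipotents to
  -- lower ones.
  set w : SL(2, ℝ) := upperUni 1 * lowerUni (-1) * upperUni 1 with hw
  have hχw : χ w = w := by rw [hw, map_mul, map_mul, hu, hl]
  have hlow : ∀ t, χ (lowerUni t) = lowerUni t := by
    intro t
    have : lowerUni t = w * upperUni (-t) * w⁻¹ := by
      rw [eq_mul_inv_iff_mul_eq, hw]
      apply sl_ext
      simp only [Matrix.SpecialLinearGroup.coe_mul, coe_upperUni, coe_lowerUni]
      ext i j
      fin_cases i <;> fin_cases j <;> simp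
    rw [this, map_mul, map_mul, map_inv, hχw, hup]
  have htop := eq_top_of_unipotent_mem (MonoidHom.eqLocus χ.toMonoidHom (MonoidHom.id _)) hup hlow
  ext1 g
  have : g ∈ MonoidHom.eqLocus χ.toMonoidHom (MonoidHom.id _) := htop ▸ Subgroup.mem_top g
  exact this

/-- Every automorphism of `SL(2,ℝ)` is conjugation by an invertible matrix. -/
theorem exists_eq_glConj (φ : MulAut SL(2, ℝ)) : ∃ P : GL (Fin 2) ℝ, φ = glConj P := by
  have hne : φ (upperUni 1) ≠ 1 := by
    rw [Ne, map_eq_one_iff φ φ.injective, ← upperUni_zero, upperUni_injective.eq_iff]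
    exact one_ne_zero
  obtain ⟨P, hP⟩ := exists_glConj_eq_upperUni_one (trace_map_upperUni φ 1) hne
  set ψ : MulAut SL(2, ℝ) := glConj P * φ with hψ
  have hψu : ψ (upperUni 1) = upperUni 1 := hP
  set X := ψ (lowerUni (-1)) with hX
  have htr : (X : Mat2).trace = 2 := trace_map_lowerUni ψ (-1)
  have hd := X.det_coe
  rw [Matrix.det_fin_two] at hd
  rw [Matrix.trace_fin_two] at htr
  -- Otherwise X would be upper unipotent and commute with `upperUni 1`, but their preimages under ψ
  -- do not commute.
  have hc : (X : Mat2) 1 0 ≠ 0 := by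
    intro hc
    rw [hc, mul_zero, sub_zero] at hd
    have ha : (X : Mat2) 0 0 = 1 := by nlinarith
    have hXu : X = upperUni ((X : Mat2) 0 1) := by
      apply sl_ext
      ext i j
      fin_cases i <;> fin_cases j <;> simp [coe_upperUni, ha, hc]
      linarith
    have hcomm : X * upperUni 1 = upperUni 1 * X := by
      rw [hXu, ← upperUni_add, ← upperUni_add, add_comm]
    rw [hX] at hcomm
    conv_lhs at hcomm => rw [← hψu]
    conv_rhs at hcomm => rw [← hψu]
    rw [← map_mul, ← map_mul, ψ.injective.eq_iff] at hcomm
    have := congrFun (congrFun (congrArg Subtype.val hcomm) 0) 0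
    simp [coe_upperUni, coe_lowerUni] at this
  -- The line fixed by X is spanned by (X₀₀ - 1, X₁₀); this s makes `upperUni s` move it to the
  -- second axis.
  set s := -((X : Mat2) 0 0 - 1) / (X : Mat2) 1 0 with hs
  set χ : MulAut SL(2, ℝ) := MulAut.conj (upperUni s) * ψ with hχ
  have hχu : χ (upperUni 1) = upperUni 1 := by
    rw [hχ, MulAut.mul_apply, hψu, MulAut.conj_apply, mul_inv_eq_iff_eq_mul, ← upperUni_add,
      ← upperUni_add, add_comm]
  have hχl : χ (lowerUni (-1)) = lowerUni ((X : Mat2) 1 0) := by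
    rw [hχ, MulAut.mul_apply, ← hX, MulAut.conj_apply, mul_inv_eq_iff_eq_mul]
    apply sl_ext
    simp only [Matrix.SpecialLinearGroup.coe_mul, coe_upperUni, coe_lowerUni]
    have hsc : s * (X : Mat2) 1 0 = 1 - (X : Mat2) 0 0 := by rw [hs]; field_simp; ring
    ext i j
    fin_cases i <;> fin_cases j <;> simp [Matrix.mul_apply]
    · linarith
    · apply mul_right_cancel₀ hc
      linear_combination ((X : Mat2) 1 1 - 1) * hsc - hd + htr
    · linarith
  -- The braid relation between the two unipotents fixes the one remaining parameter.
  have hbraid : upperUni 1 * lowerUni (-1) * upperUni 1 =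
      lowerUni (-1) * upperUni 1 * lowerUni (-1) := by
    apply sl_ext
    simp [coe_upperUni, coe_lowerUni]
  have hc1 : (X : Mat2) 1 0 = -1 := by
    have := congrArg χ hbraid
    simp only [map_mul, hχu, hχl] at this
    have := congrFun (congrFun (congrArg Subtype.val this) 0) 1
    simp [coe_upperUni, coe_lowerUni] at this
    linarith
  have hone := eq_one_of_fix χ hχu (hχl.trans (by rw [hc1]))
  refine ⟨P⁻¹ * (upperUni s : GL (Fin 2) ℝ)⁻¹, ?_⟩
  ext1 g
  have hg : upperUni s * glConj P (φ g) * (upperUni s)⁻¹ = g := by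
    have := congrArg (fun f : MulAut SL(2, ℝ) => f g) hone
    exact this
  have hg' : glConjHom (upperUni s * P) (φ g) = g := by
    rw [glConjHom_mul_apply]
    refine Eq.trans (sl_ext ?_) hg
    rw [coe_glConjHom, ← map_inv, Matrix.SpecialLinearGroup.coe_mul,
      Matrix.SpecialLinearGroup.coe_mul]
    rfl
  rw [← mul_inv_rev, glConj_apply]
  conv_rhs => rw [← hg', ← glConjHom_mul_apply, inv_mul_cancel, glConjHom_one_apply]

/-- An automorphism of `SL(2,ℝ)` which is not inner is conjugation by a matrix of determinant
`-1`. -/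
theorem exists_det_eq_neg_one (φ : MulAut SL(2, ℝ))
    (hφ : ¬ ∃ h : SL(2, ℝ), ∀ g : SL(2, ℝ), φ g = h * g * h⁻¹) :
    ∃ h k : Mat2, h.det = -1 ∧ h * k = 1 ∧ ∀ g, (φ g : Mat2) = h * g * k := by
  obtain ⟨P, rfl⟩ := exists_eq_glConj φ
  have hPP : (P : Mat2) * ((P⁻¹ : GL (Fin 2) ℝ) : Mat2) = 1 := by
    rw [← Units.val_mul, mul_inv_cancel, Units.val_one]
  have hdet : (P : Mat2).det ≠ 0 := by
    intro h0
    have := congrArg Matrix.det hPP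
    rw [Matrix.det_mul, h0, zero_mul, Matrix.det_one] at this
    exact zero_ne_one this
  have habs := abs_pos.mpr hdet
  -- Rescaling P leaves the conjugation unchanged and normalizes the determinant to ±1.
  set r := √|(P : Mat2).det| with hr
  have hr0 : r ≠ 0 := (Real.sqrt_pos.mpr habs).ne'
  have hr2 : r ^ 2 = |(P : Mat2).det| := Real.sq_sqrt habs.le
  have hmul : (r⁻¹ • (P : Mat2)) * (r • ((P⁻¹ : GL (Fin 2) ℝ) : Mat2)) = 1 := by
    rw [smul_mul_smul_comm, inv_mul_cancel₀ hr0, one_smul, hPP]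
  have hconj : ∀ g : SL(2, ℝ), (glConj P g : Mat2) =
      (r⁻¹ • (P : Mat2)) * g * (r • ((P⁻¹ : GL (Fin 2) ℝ) : Mat2)) := by
    intro g
    rw [coe_glConj, smul_mul_assoc, smul_mul_smul_comm, inv_mul_cancel₀ hr0, one_smul]
  have hdet' : (r⁻¹ • (P : Mat2)).det = (P : Mat2).det / |(P : Mat2).det| := by
    rw [Matrix.det_smul, Fintype.card_fin, inv_pow, hr2, inv_mul_eq_div]
  refine ⟨_, _, ?_, hmul, hconj⟩
  rcases lt_or_gt_of_ne hdet with h | h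
  · rw [hdet', abs_of_neg h, div_neg, div_self hdet]
  · exfalso
    apply hφ
    rw [abs_of_pos h, div_self hdet] at hdet'
    let S : SL(2, ℝ) := ⟨_, hdet'⟩
    have hS : (S : Mat2) = r⁻¹ • (P : Mat2) := rfl
    refine ⟨S, fun g => ?_⟩
    rw [eq_mul_inv_iff_mul_eq]
    apply sl_ext
    rw [Matrix.SpecialLinearGroup.coe_mul, Matrix.SpecialLinearGroup.coe_mul, hconj, hS, mul_assoc,
      mul_eq_one_comm.mp hmul, mul_one]

/-! ### The adjoint representation and SO_∘(2,1) -/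

theorem stdForm_two_one_apply (v : Fin (2 + 1) → ℝ) :
    stdForm 2 1 v = -(v 0) ^ 2 - v 1 ^ 2 + v 2 ^ 2 := by
  simp [stdForm, QuadraticMap.weightedSumSquares_apply, Fin.sum_univ_succ]
  ring

/-- The isomorphism of `ℝ^{2,1}` with the traceless matrices, with the form `det`. -/
def toTraceless (v : Fin (2 + 1) → ℝ) : Mat2 := !![v 0, v 1 + v 2; v 1 - v 2, -v 0]

theorem det_toTraceless (v : Fin (2 + 1) → ℝ) : (toTraceless v).det = stdForm 2 1 v := by
  rw [stdForm_two_one_apply, toTraceless, Matrix.det_fin_two_of]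
  ring

theorem toTraceless_injective : Function.Injective toTraceless := by
  intro v w h
  have h0 := congrFun (congrFun h 0) 0
  have h1 := congrFun (congrFun h 0) 1
  have h2 := congrFun (congrFun h 1) 0
  simp [toTraceless] at h0 h1 h2
  ext i
  fin_cases i
  · exact h0
  · change v 1 = w 1
    linarith
  · change v 2 = w 2
    linarith

/-- The matrix of the adjoint action on traceless matrices. -/
def adMat (A : Mat2) : Matrix (Fin (2 + 1)) (Fin (2 + 1)) ℝ :=
  !![A 0 0 * A 1 1 + A 0 1 * A 1 0, A 0 1 * A 1 1 - A 0 0 * A 1 0,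
      -(A 0 1 * A 1 1 + A 0 0 * A 1 0);
    A 1 0 * A 1 1 - A 0 0 * A 0 1, (A 0 0 ^ 2 - A 0 1 ^ 2 + A 1 1 ^ 2 - A 1 0 ^ 2) / 2,
      (A 0 0 ^ 2 + A 0 1 ^ 2 - A 1 0 ^ 2 - A 1 1 ^ 2) / 2;
    -(A 0 0 * A 0 1 + A 1 0 * A 1 1), (A 0 0 ^ 2 - A 0 1 ^ 2 - A 1 1 ^ 2 + A 1 0 ^ 2) / 2,
      (A 0 0 ^ 2 + A 0 1 ^ 2 + A 1 0 ^ 2 + A 1 1 ^ 2) / 2]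

/-- Multiplicativity of `adMat` and invariance of the form follow from this intertwining relation,
without expanding products of 3×3 matrices. -/
theorem toTraceless_adMat_mulVec (A : SL(2, ℝ)) (v : Fin (2 + 1) → ℝ) :
    toTraceless ((adMat A).mulVec v) =
      (A : Mat2) * toTraceless v * ((A⁻¹ : SL(2, ℝ)) : Mat2) := by
  rw [Matrix.SpecialLinearGroup.coe_inv, Matrix.adjugate_fin_two]
  ext i j
  fin_cases i <;> fin_cases j <;>
    simp [toTraceless, adMat, Matrix.mulVec, dotProduct, Fin.sum_univ_succ, Matrix.mul_apply] <;>
    ring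

/-- The adjoint representation of `SL(2,ℝ)`. -/
def adHom : SL(2, ℝ) →* Matrix (Fin (2 + 1)) (Fin (2 + 1)) ℝ where
  toFun A := adMat A
  map_one' := by
    apply Matrix.mulVec_injective
    funext v
    apply toTraceless_injective
    rw [toTraceless_adMat_mulVec]
    simp
  map_mul' A B := by
    apply Matrix.mulVec_injective
    funext v
    apply toTraceless_injective
    rw [← Matrix.mulVec_mulVec, toTraceless_adMat_mulVec, toTraceless_adMat_mulVec,
      toTraceless_adMat_mulVec, mul_inv_rev, Matrix.SpecialLinearGroup.coe_mul,
      Matrix.SpecialLinearGroup.coe_mul]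
    simp only [mul_assoc]

theorem adHom_apply (A : SL(2, ℝ)) : adHom A = adMat A := rfl

theorem stdForm_adMat_mulVec (A : SL(2, ℝ)) (v : Fin (2 + 1) → ℝ) :
    stdForm 2 1 ((adMat A).mulVec v) = stdForm 2 1 v := by
  rw [← det_toTraceless, toTraceless_adMat_mulVec, ← det_toTraceless]
  simp only [Matrix.det_mul, Matrix.SpecialLinearGroup.det_coe, one_mul, mul_one]

/-- The adjoint representation as a homomorphism to `O(2,1)`. -/
def adO : SL(2, ℝ) →* indefO 2 1 :=
  adHom.toHomUnits.codRestrict (indefO 2 1) fun A v => stdForm_adMat_mulVec A v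

theorem continuous_adMat : Continuous fun A : SL(2, ℝ) => adMat A := by
  have h : ∀ i j, Continuous fun A : SL(2, ℝ) => (A : Mat2) i j := fun i j =>
    (continuous_subtype_val (p := fun A : Mat2 => A.det = 1)).matrix_elem i j
  have h00 := h 0 0
  have h01 := h 0 1
  have h10 := h 1 0
  have h11 := h 1 1
  refine continuous_matrix fun i j => ?_
  fin_cases i <;> fin_cases j <;> simp [adMat] <;> fun_prop

theorem continuous_adO : Continuous adO := by
  refine Continuous.subtype_mk (Units.continuous_iff.mpr ⟨continuous_adMat, ?_⟩) _
  exact continuous_adMat.comp continuous_inv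

theorem mem_connectedComponent_of_path {G : Type*} [TopologicalSpace G] [Group G] (f : ℝ → G)
    (hf : Continuous f) (h0 : f 0 = 1) (t : ℝ) : f t ∈ connectedComponent (1 : G) :=
  (isPreconnected_range hf).subset_connectedComponent ⟨0, h0⟩ ⟨t, rfl⟩

theorem continuous_upperUni : Continuous upperUni := by
  refine Continuous.subtype_mk (continuous_matrix fun i j => ?_) _
  fin_cases i <;> fin_cases j <;> simp <;> fun_prop

theorem continuous_lowerUni : Continuous lowerUni := by
  refine Continuous.subtype_mk (continuous_matrix fun i j => ?_) _
  fin_cases i <;> fin_cases j <;> simp <;> fun_prop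

/-- The unipotent one-parameter subgroups are paths through 1, and they generate SL(2,ℝ). -/
theorem adO_mem_connectedComponentOfOne (A : SL(2, ℝ)) :
    adO A ∈ Subgroup.connectedComponentOfOne (indefO 2 1) := by
  have h := eq_top_of_unipotent_mem ((Subgroup.connectedComponentOfOne (indefO 2 1)).comap adO)
    (mem_connectedComponent_of_path (fun t => adO (upperUni t))
      (continuous_adO.comp continuous_upperUni) (by rw [upperUni_zero, map_one]))
    (mem_connectedComponent_of_path (fun t => adO (lowerUni t))
      (continuous_adO.comp continuous_lowerUni) (by rw [lowerUni_zero, map_one]))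
  have hA : A ∈ (Subgroup.connectedComponentOfOne (indefO 2 1)).comap adO := by
    rw [h]
    exact Subgroup.mem_top A
  exact hA

/-- A nowhere vanishing continuous function has constant sign on connected components. -/
theorem pos_of_mem_connectedComponent {X : Type*} [TopologicalSpace X] {f : X → ℝ}
    (hf : Continuous f) (hne : ∀ x, f x ≠ 0) {a b : X} (ha : 0 < f a)
    (hb : b ∈ connectedComponent a) : 0 < f b := by
  by_contra! h
  obtain ⟨x, -, hx⟩ := isPreconnected_connectedComponent.intermediate_value hb
    mem_connectedComponent hf.continuousOn ⟨h, ha.le⟩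
  exact hne x hx

theorem det_adMat (A : SL(2, ℝ)) : (adMat A).det = 1 := by
  have hd := A.det_coe
  rw [Matrix.det_fin_two] at hd
  have : (adMat A).det =
      ((A : Mat2) 0 0 * (A : Mat2) 1 1 - (A : Mat2) 0 1 * (A : Mat2) 1 0) ^ 3 := by
    rw [adMat, Matrix.det_fin_three]
    simp
    ring
  rw [this, hd, one_pow]

theorem stdForm_mulVec_explicit {M : Matrix (Fin (2 + 1)) (Fin (2 + 1)) ℝ}
    (hM : ∀ v, stdForm 2 1 (M.mulVec v) = stdForm 2 1 v) (x y z : ℝ) :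
    -(M 0 0 * x + M 0 1 * y + M 0 2 * z) ^ 2 - (M 1 0 * x + M 1 1 * y + M 1 2 * z) ^ 2 +
      (M 2 0 * x + M 2 1 * y + M 2 2 * z) ^ 2 = -x ^ 2 - y ^ 2 + z ^ 2 := by
  have := hM ![x, y, z]
  rw [stdForm_two_one_apply, stdForm_two_one_apply] at this
  simp [Matrix.mulVec, dotProduct, Fin.sum_univ_succ] at this
  linear_combination this

/-- `SL(2,ℝ)` acts transitively on the upper sheet of the hyperboloid. -/
theorem exists_adMat_col_two_eq {a m n : ℝ} (h : -a ^ 2 - m ^ 2 + n ^ 2 = 1) (hn : 0 < n) :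
    ∃ A : SL(2, ℝ), adMat A 0 2 = a ∧ adMat A 1 2 = m ∧ adMat A 2 2 = n := by
  have hmn : 0 < m + n := by nlinarith [sq_nonneg a]
  set α := √(m + n) with hα
  have hα0 : α ≠ 0 := (Real.sqrt_pos.mpr hmn).ne'
  have hα2 : α ^ 2 = m + n := Real.sq_sqrt hmn.le
  have hs : (-a / α) ^ 2 + (α⁻¹) ^ 2 = n - m := by
    field_simp
    rw [hα2]
    linear_combination -h
  rw [inv_pow] at hs
  -- Lower triangular matrices already act transitively: the last two coordinates of the image add
  -- up to α², and the first one gives the off-diagonal entry.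
  refine ⟨⟨!![α, 0; -a / α, α⁻¹], by simp [Matrix.det_fin_two, hα0]⟩, ?_, ?_, ?_⟩
  · simp [adMat]
    field_simp
  · simp [adMat]
    linarith
  · simp [adMat]
    linarith

/-- An isometry fixing the positive axis preserves the negative plane; positive determinant makes it
a rotation there. It is the adjoint action of the rotation by half the angle. -/
theorem exists_adMat_eq_of_fix {N : Matrix (Fin (2 + 1)) (Fin (2 + 1)) ℝ}
    (hN : ∀ v, stdForm 2 1 (N.mulVec v) = stdForm 2 1 v) (hdet : 0 < N.det)
    (h0 : N 0 2 = 0) (h1 : N 1 2 = 0) (h2 : N 2 2 = 1) : ∃ A : SL(2, ℝ), adMat A = N := by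
  have hN' := stdForm_mulVec_explicit hN
  rw [h0, h1, h2] at hN'
  have h20 : N 2 0 = 0 := by linear_combination (hN' 1 0 1 - hN' 1 0 0) / 2
  have h21 : N 2 1 = 0 := by linear_combination (hN' 0 1 1 - hN' 0 1 0) / 2
  rw [h20, h21] at hN'
  have hc0 : N 0 0 ^ 2 + N 1 0 ^ 2 = 1 := by linear_combination -hN' 1 0 0
  have hc1 : N 0 1 ^ 2 + N 1 1 ^ 2 = 1 := by linear_combination -hN' 0 1 0
  have hc01 : N 0 0 * N 0 1 + N 1 0 * N 1 1 = 0 := by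
    linear_combination (hN' 1 0 0 + hN' 0 1 0 - hN' 1 1 0) / 2
  have hd : N.det = N 0 0 * N 1 1 - N 0 1 * N 1 0 := by
    have := Matrix.det_fin_three N
    rw [h0, h1, h2, h20, h21] at this
    rw [this]
    ring
  have hd2 : N.det ^ 2 = 1 := by
    rw [hd]
    linear_combination (N 0 1 ^ 2 + N 1 1 ^ 2) * hc0 + hc1 -
      (N 0 0 * N 0 1 + N 1 0 * N 1 1) * hc01
  have hd1 : N.det = 1 := by nlinarith
  have hsum : (N 0 0 - N 1 1) ^ 2 + (N 0 1 + N 1 0) ^ 2 = 0 := by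
    linear_combination hc0 + hc1 - 2 * (hd.symm.trans hd1)
  have e11 : N 1 1 = N 0 0 := by nlinarith [sq_nonneg (N 0 0 - N 1 1), sq_nonneg (N 0 1 + N 1 0)]
  have e01 : N 0 1 = -N 1 0 := by nlinarith [sq_nonneg (N 0 0 - N 1 1), sq_nonneg (N 0 1 + N 1 0)]
  -- A complex square root supplies the half angle.
  obtain ⟨w, hw⟩ := IsAlgClosed.exists_pow_nat_eq (⟨N 0 0, N 1 0⟩ : ℂ) (n := 2) two_pos
  have hre : w.re ^ 2 - w.im ^ 2 = N 0 0 := by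
    simpa [pow_two] using congrArg Complex.re hw
  have him : 2 * w.re * w.im = N 1 0 := by
    have := congrArg Complex.im hw
    simp [pow_two] at this
    linarith
  have hnorm : w.re ^ 2 + w.im ^ 2 = 1 := by
    have : (w.re ^ 2 + w.im ^ 2) ^ 2 = 1 := by
      rw [← hc0, ← hre, ← him]
      ring
    nlinarith [sq_nonneg w.re, sq_nonneg w.im]
  refine ⟨⟨!![w.re, -w.im; w.im, w.re], by
    rw [Matrix.det_fin_two_of]
    linear_combination hnorm⟩, ?_⟩
  ext i j
  fin_cases i <;> fin_cases j <;> simp [adMat, h0, h1, h2, h20, h21, e11, e01]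
  · linear_combination hre
  · linear_combination -him
  · ring
  · linear_combination him
  · linear_combination hre
  · ring
  · linear_combination hnorm

theorem exists_adMat_eq {M : Matrix (Fin (2 + 1)) (Fin (2 + 1)) ℝ}
    (hM : ∀ v, stdForm 2 1 (M.mulVec v) = stdForm 2 1 v) (hdet : 0 < M.det)
    (h22 : 0 < M 2 2) : ∃ A : SL(2, ℝ), adMat A = M := by
  have hM' := stdForm_mulVec_explicit hM 0 0 1
  obtain ⟨A, h0, h1, h2⟩ := exists_adMat_col_two_eq (a := M 0 2) (m := M 1 2) (n := M 2 2)
    (by linear_combination hM') h22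
  -- A sends the third basis vector to the third column of M, so N fixes that vector.
  set N := adHom A⁻¹ * M with hN
  have hAN : M = adHom A * N := by
    rw [hN, ← mul_assoc, ← map_mul, mul_inv_cancel, map_one, one_mul]
  have hcol : ∀ i, N i 2 = (1 : Matrix (Fin (2 + 1)) (Fin (2 + 1)) ℝ) i 2 := by
    intro i
    rw [← map_one adHom, ← inv_mul_cancel A, map_mul, hN, Matrix.mul_apply, Matrix.mul_apply]
    refine Finset.sum_congr rfl fun j _ => ?_
    congr 1
    fin_cases j
    · exact h0.symm
    · exact h1.symm
    · exact h2.symm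
  obtain ⟨B, hB⟩ := exists_adMat_eq_of_fix (N := N)
    (fun v => by rw [hN, ← Matrix.mulVec_mulVec, adHom_apply, stdForm_adMat_mulVec, hM])
    (by rwa [hN, Matrix.det_mul, adHom_apply, det_adMat, one_mul])
    (by simp [hcol]) (by simp [hcol]) (by simp [hcol])
  exact ⟨A * B, by rw [hAN, ← hB, ← adHom_apply, ← adHom_apply, map_mul]⟩

/-- The image of the adjoint representation is the identity component of `O(2,1)`. -/
theorem mem_indefSO0_iff (g : GL (Fin (2 + 1)) ℝ) :
    g ∈ indefSO0 2 1 ↔ ∃ A : SL(2, ℝ), ((adO A : indefO 2 1) : GL (Fin (2 + 1)) ℝ) = g := by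
  constructor
  · rintro ⟨k, hk, rfl⟩
    have hval : Continuous fun k : indefO 2 1 =>
        ((k : GL (Fin (2 + 1)) ℝ) : Matrix (Fin (2 + 1)) (Fin (2 + 1)) ℝ) :=
      Units.continuous_val.comp continuous_subtype_val
    have hdet : 0 < ((k : GL (Fin (2 + 1)) ℝ) : Matrix (Fin (2 + 1)) (Fin (2 + 1)) ℝ).det :=
      pos_of_mem_connectedComponent (hval.matrix_det)
        (fun k => ((Matrix.isUnit_iff_isUnit_det _).mp (Units.isUnit _)).ne_zero) (by simp) hk
    have h22 : 0 < ((k : GL (Fin (2 + 1)) ℝ) : Matrix (Fin (2 + 1)) (Fin (2 + 1)) ℝ) 2 2 :=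
      -- Isometry gives M₂₂² = 1 + M₀₂² + M₁₂², so this entry never vanishes.
      pos_of_mem_connectedComponent (hval.matrix_elem 2 2) (fun k h => by
        have := stdForm_mulVec_explicit k.2 0 0 1
        rw [h] at this
        nlinarith) (by simp) hk
    obtain ⟨A, hA⟩ := exists_adMat_eq k.2 hdet h22
    exact ⟨A, Units.ext hA⟩
  · rintro ⟨A, rfl⟩
    exact ⟨adO A, adO_mem_connectedComponentOfOne A, rfl⟩

/-! ### The invariant spacelike line -/

section Conjugation

variable {φ : MulAut SL(2, ℝ)} {h k : Mat2}

/-- Here φ(g)⁻¹ = h g⁻¹ k, and its h cancels the k on the right of Y. The action of the graph thus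
becomes conjugation. -/
theorem actMat_map_mul (hk : h * k = 1) (hφ : ∀ g, (φ g : Mat2) = h * g * k) (g : SL(2, ℝ))
    (Y : Mat2) :
    actMat (g, φ g) (Y * k) = (g : Mat2) * Y * ((g⁻¹ : SL(2, ℝ)) : Mat2) * k := by
  have hkh : k * h = 1 := mul_eq_one_comm.mp hk
  rw [actMat_apply, ← map_inv, hφ]
  simp only [mul_assoc]
  rw [← mul_assoc k h, hkh, one_mul]

theorem mem_graph_iff (φ : MulAut SL(2, ℝ)) (p : SL(2, ℝ) × SL(2, ℝ)) :
    p ∈ φ.toMonoidHom.graph ↔ ∃ g, p = (g, φ g) := by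
  rw [MonoidHom.mem_graph]
  constructor
  · intro hp
    exact ⟨p.1, Prod.ext rfl hp.symm⟩
  · rintro ⟨g, rfl⟩
    rfl

/-- One upper and one lower unipotent suffice: a nonzero off-diagonal entry would force the factor
to be 1, and a diagonal entry then makes that entry vanish. -/
theorem eq_smul_one_of_conj_eq_smul {Y : Mat2} (hdet : Y.det ≠ 0)
    (hY : ∀ g : SL(2, ℝ), ∃ c : ℝ, (g : Mat2) * Y * ((g⁻¹ : SL(2, ℝ)) : Mat2) = c • Y) :
    ∃ c : ℝ, Y = c • (1 : Mat2) := by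
  have hY' : ∀ g : SL(2, ℝ), ∃ c : ℝ, (g : Mat2) * Y = c • (Y * (g : Mat2)) := by
    intro g
    obtain ⟨c, hc⟩ := hY g
    refine ⟨c, ?_⟩
    rw [← smul_mul_assoc, ← hc, mul_assoc _ _ (g : Mat2), ← Matrix.SpecialLinearGroup.coe_mul,
      inv_mul_cancel, Matrix.SpecialLinearGroup.coe_one, mul_one]
  rw [Matrix.det_fin_two] at hdet
  obtain ⟨c, hc⟩ := hY' (upperUni 1)
  obtain ⟨d, hd⟩ := hY' (lowerUni 1)
  have c00 := congrFun (congrFun hc 0) 0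
  have c01 := congrFun (congrFun hc 0) 1
  have c10 := congrFun (congrFun hc 1) 0
  have d00 := congrFun (congrFun hd 0) 0
  have d01 := congrFun (congrFun hd 0) 1
  have d11 := congrFun (congrFun hd 1) 1
  simp [coe_upperUni, coe_lowerUni, Matrix.mul_apply] at c00 c01 c10 d00 d01 d11
  have h10 : Y 1 0 = 0 := by
    by_contra hne
    have hc1 : c = 1 := by
      apply mul_right_cancel₀ hne
      linarith
    rw [hc1] at c00
    exact hne (by linarith)
  have h01 : Y 0 1 = 0 := by
    by_contra hne
    have hd1 : d = 1 := by
      apply mul_right_cancel₀ hne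
      linarith
    rw [hd1] at d11
    exact hne (by linarith)
  rw [h10, mul_zero, sub_zero] at hdet
  have hne : Y 0 0 ≠ 0 := left_ne_zero_of_mul hdet
  have hc1 : c = 1 := by
    apply mul_right_cancel₀ hne
    linarith
  rw [hc1, h01] at c01
  refine ⟨Y 0 0, ?_⟩
  ext i j
  fin_cases i <;> fin_cases j <;> simp [h10, h01]
  linarith

/-- For conjugation by a matrix of determinant `-1`, the graph has a unique invariant spacelike
line. -/
theorem existsUnique_spacelikeLine (hdet : h.det = -1) (hk : h * k = 1)
    (hφ : ∀ g, (φ g : Mat2) = h * g * k) :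
    ∃! L : Submodule ℝ Mat2, IsSpacelikeLine negDet L ∧
      ∀ g ∈ φ.toMonoidHom.graph, L.map (actMat g) = L := by
  have hkh : k * h = 1 := mul_eq_one_comm.mp hk
  have hkdet : k.det = -1 := by
    have := congrArg Matrix.det hk
    rw [Matrix.det_mul, hdet, Matrix.det_one] at this
    linarith
  have hk0 : k ≠ 0 := by
    rintro rfl
    simp at hkdet
  refine ⟨ℝ ∙ k, ⟨⟨finrank_span_singleton hk0, ?_⟩, ?_⟩, ?_⟩
  · intro v hv hv0
    obtain ⟨c, rfl⟩ := Submodule.mem_span_singleton.mp hv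
    have hc : c ≠ 0 := by
      rintro rfl
      simp at hv0
    rw [negDet_apply, Matrix.det_smul, hkdet, Fintype.card_fin]
    have := sq_pos_of_ne_zero hc
    linarith
  · intro p hp
    obtain ⟨g, rfl⟩ := (mem_graph_iff φ p).mp hp
    rw [Submodule.map_span, Set.image_singleton]
    have := actMat_map_mul hk hφ g 1
    rw [one_mul, mul_one, ← Matrix.SpecialLinearGroup.coe_mul, mul_inv_cancel,
      Matrix.SpecialLinearGroup.coe_one, one_mul] at this
    rw [this]
  · rintro L ⟨⟨hL1, hLpos⟩, hLinv⟩
    refine Submodule.eq_of_le_of_finrank_eq (fun v hv => ?_)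
      (hL1.trans (finrank_span_singleton hk0).symm)
    by_cases hv0 : v = 0
    · rw [hv0]
      exact Submodule.zero_mem _
    have hvdet := hLpos v hv hv0
    rw [negDet_apply] at hvdet
    have hvk : v = v * h * k := by rw [mul_assoc, hk, mul_one]
    obtain ⟨c, hc⟩ := eq_smul_one_of_conj_eq_smul (Y := v * h)
      (by rw [Matrix.det_mul, hdet]; linarith) (fun g => by
        have hmem : actMat (g, φ g) v ∈ L := by
          rw [← hLinv _ ((mem_graph_iff φ _).mpr ⟨g, rfl⟩)]
          exact Submodule.mem_map_of_mem hv
        obtain ⟨c, hc⟩ := exists_smul_eq_of_finrank_eq_one hL1 (x := (⟨v, hv⟩ : L))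
          (by simpa using hv0) ⟨_, hmem⟩
        have hc' : c • v = actMat (g, φ g) v := congrArg Subtype.val hc
        rw [hvk, actMat_map_mul hk hφ] at hc'
        refine ⟨c, ?_⟩
        have := congrArg (· * h) hc'
        simp only [smul_mul_assoc, mul_assoc, hkh, mul_one] at this
        simp only [mul_assoc]
        exact this.symm)
    rw [hvk, hc, smul_mul_assoc, one_mul]
    exact Submodule.smul_mem _ _ (Submodule.mem_span_singleton_self k)

/-! ### The isometry with ℝ^{2,1} ⊕ ℝ^{0,2} -/

theorem blockEnd_apply_inl (g : GL (Fin (2 + 1)) ℝ) (v : Fin (2 + 3) → ℝ) (i : Fin (2 + 1)) :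
    blockEnd g v (splitIndex (Sum.inl i)) =
      (g : Matrix (Fin (2 + 1)) (Fin (2 + 1)) ℝ).mulVec (fun j => v (splitIndex (Sum.inl j))) i := by
  rw [blockEnd, Matrix.toLin'_apply, Matrix.reindex_apply, Matrix.submatrix_mulVec_equiv,
    Matrix.fromBlocks_mulVec]
  simp [Function.comp_def]

theorem blockEnd_apply_inr (g : GL (Fin (2 + 1)) ℝ) (v : Fin (2 + 3) → ℝ) (i : Fin 2) :
    blockEnd g v (splitIndex (Sum.inr i)) = v (splitIndex (Sum.inr i)) := by
  rw [blockEnd, Matrix.toLin'_apply, Matrix.reindex_apply, Matrix.submatrix_mulVec_equiv,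
    Matrix.fromBlocks_mulVec]
  simp [Function.comp_def]

theorem stdForm_two_three_apply (v : Fin (2 + 3) → ℝ) :
    stdForm 2 3 v = stdForm 2 1 (fun i => v (splitIndex (Sum.inl i))) +
      v (splitIndex (Sum.inr 0)) ^ 2 + v (splitIndex (Sum.inr 1)) ^ 2 := by
  rw [stdForm_two_one_apply]
  change _ = -(v 0) ^ 2 - v 1 ^ 2 + v 2 ^ 2 + v 3 ^ 2 + v 4 ^ 2
  simp [stdForm, QuadraticMap.weightedSumSquares_apply, Fin.sum_univ_succ]
  ring

/-- The matrix with traceless part given by the first three coordinates, and scalar part by the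
fourth one. -/
def coordMat (v : Fin (2 + 3) → ℝ) : Mat2 :=
  v (splitIndex (Sum.inr 0)) • (1 : Mat2) + toTraceless (fun i => v (splitIndex (Sum.inl i)))

theorem det_coordMat (v : Fin (2 + 3) → ℝ) :
    (coordMat v).det =
      v (splitIndex (Sum.inr 0)) ^ 2 + stdForm 2 1 (fun i => v (splitIndex (Sum.inl i))) := by
  rw [stdForm_two_one_apply, coordMat, Matrix.det_fin_two]
  simp [toTraceless]
  ring

/-- The linear isomorphism of `ℝ^{2,3}` with `M(2,ℝ) ⊕ ℝ`, twisted by right multiplication with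
an invertible matrix. -/
def coordEquiv (hk : h * k = 1) : (Fin (2 + 3) → ℝ) ≃ₗ[ℝ] E23 where
  toFun v := (coordMat v * k, v (splitIndex (Sum.inr 1)))
  map_add' v w := by
    refine Prod.ext ?_ rfl
    change coordMat (v + w) * k = coordMat v * k + coordMat w * k
    rw [← add_mul]
    congr 1
    ext i j
    fin_cases i <;> fin_cases j <;> simp [coordMat, toTraceless] <;> ring
  map_smul' c v := by
    refine Prod.ext ?_ rfl
    change coordMat (c • v) * k = c • (coordMat v * k)
    rw [← smul_mul_assoc]
    congr 1
    ext i j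
    fin_cases i <;> fin_cases j <;> simp [coordMat, toTraceless] <;> ring
  -- Multiplying by h undoes k; the half-trace gives the scalar part and the other half-sums and
  -- half-differences give the traceless part.
  invFun p := fun i => Sum.elim
    ![((p.1 * h) 0 0 - (p.1 * h) 1 1) / 2, ((p.1 * h) 0 1 + (p.1 * h) 1 0) / 2,
      ((p.1 * h) 0 1 - (p.1 * h) 1 0) / 2]
    ![((p.1 * h) 0 0 + (p.1 * h) 1 1) / 2, p.2] (splitIndex.symm i)
  left_inv v := by
    ext i
    obtain ⟨x, rfl⟩ := splitIndex.surjective i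
    have hY : coordMat v * k * h = coordMat v := by
      rw [mul_assoc, mul_eq_one_comm.mp hk, mul_one]
    simp only [hY, Equiv.symm_apply_apply]
    rcases x with x | x <;> fin_cases x <;> simp [coordMat, toTraceless] <;> ring
  right_inv p := by
    refine Prod.ext ?_ (by simp)
    have hX : p.1 = p.1 * h * k := by rw [mul_assoc, hk, mul_one]
    conv_rhs => rw [hX]
    dsimp only
    congr 1
    ext i j
    fin_cases i <;> fin_cases j <;> simp [coordMat, toTraceless] <;> ring

theorem coordEquiv_apply (hk : h * k = 1) (v : Fin (2 + 3) → ℝ) :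
    coordEquiv hk v = (coordMat v * k, v (splitIndex (Sum.inr 1))) := rfl

theorem q23_coordEquiv (hdet : h.det = -1) (hk : h * k = 1) (v : Fin (2 + 3) → ℝ) :
    q23 (coordEquiv hk v) = stdForm 2 3 v := by
  have hkdet : k.det = -1 := by
    have := congrArg Matrix.det hk
    rw [Matrix.det_mul, hdet, Matrix.det_one] at this
    linarith
  rw [coordEquiv_apply, q23_apply, Matrix.det_mul, hkdet, det_coordMat, stdForm_two_three_apply]
  ring

theorem coordMat_blockEnd (g : SL(2, ℝ)) (v : Fin (2 + 3) → ℝ) :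
    coordMat (blockEnd (adO g : indefO 2 1) v) =
      (g : Mat2) * coordMat v * ((g⁻¹ : SL(2, ℝ)) : Mat2) := by
  have h1 : (fun i => blockEnd (adO g : indefO 2 1) v (splitIndex (Sum.inl i))) =
      (adMat g).mulVec (fun i => v (splitIndex (Sum.inl i))) :=
    funext fun i => blockEnd_apply_inl _ v i
  rw [coordMat, h1, blockEnd_apply_inr, toTraceless_adMat_mulVec, coordMat, mul_add, add_mul,
    mul_smul_comm, mul_one, smul_mul_assoc, ← Matrix.SpecialLinearGroup.coe_mul, mul_inv_cancel,
    Matrix.SpecialLinearGroup.coe_one]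

theorem conj_actE_eq_blockEnd (hk : h * k = 1) (hφ : ∀ g, (φ g : Mat2) = h * g * k)
    (g : SL(2, ℝ)) :
    (coordEquiv hk).symm.conj (actE (g, φ g)) = blockEnd (adO g : indefO 2 1) := by
  refine LinearMap.ext fun v => ?_
  rw [LinearEquiv.conj_apply_apply, LinearEquiv.symm_symm, LinearEquiv.symm_apply_eq,
    coordEquiv_apply, coordEquiv_apply, actE_apply, coordMat_blockEnd, blockEnd_apply_inr,
    ← actMat_map_mul hk hφ, actMat_apply]

theorem exists_isometryEquiv (hdet : h.det = -1) (hk : h * k = 1)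
    (hφ : ∀ g, (φ g : Mat2) = h * g * k) :
    ∃ T : q23.IsometryEquiv (stdForm 2 3),
      (fun g => T.toLinearEquiv.conj (actE g)) ''
        (φ.toMonoidHom.graph : Set (SL(2, ℝ) × SL(2, ℝ))) = SO21in23 := by
  refine ⟨⟨(coordEquiv hk).symm, fun p => ?_⟩, ?_⟩
  · obtain ⟨v, rfl⟩ := (coordEquiv hk).surjective p
    rw [q23_coordEquiv hdet hk]
    exact congrArg _ ((coordEquiv hk).symm_apply_apply v)
  · ext f
    constructor
    · rintro ⟨p, hp, rfl⟩
      obtain ⟨g, rfl⟩ := (mem_graph_iff φ p).mp hp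
      exact ⟨_, (mem_indefSO0_iff _).mpr ⟨g, rfl⟩, (conj_actE_eq_blockEnd hk hφ g).symm⟩
    · rintro ⟨b, hb, rfl⟩
      obtain ⟨g, rfl⟩ := (mem_indefSO0_iff b).mp hb
      exact ⟨(g, φ g), (mem_graph_iff φ _).mpr ⟨g, rfl⟩, conj_actE_eq_blockEnd hk hφ g⟩

end Conjugation

end EinsteinUniverse

end

/-- The conclusion holds for every automorphism which is not inner: the orbit hypothesis is not
needed. -/
theorem lemma4p50 (φ : MulAut SL(2, ℝ))
    (hφ : ¬ ∃ h : SL(2, ℝ), ∀ g : SL(2, ℝ), φ g = h * g * h⁻¹)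
    (horb : ∃ x ∈ EinsteinUniverse.Ein12,
      EinsteinUniverse.orbitDim φ.toMonoidHom.graph x = 2) :
    (∃! L : Submodule ℝ EinsteinUniverse.Mat2,
      EinsteinUniverse.IsSpacelikeLine EinsteinUniverse.negDet L ∧
      ∀ g ∈ φ.toMonoidHom.graph, L.map (EinsteinUniverse.actMat g) = L) ∧
    ∃ T : EinsteinUniverse.q23.IsometryEquiv (EinsteinUniverse.stdForm 2 3),
      (fun g => T.toLinearEquiv.conj (EinsteinUniverse.actE g)) ''
        (φ.toMonoidHom.graph : Set (SL(2, ℝ) × SL(2, ℝ))) = EinsteinUniverse.SO21in23 := by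
  obtain ⟨h, k, hdet, hk, hconj⟩ := EinsteinUniverse.exists_det_eq_neg_one φ hφ
  exact ⟨EinsteinUniverse.existsUnique_spacelikeLine hdet hk hconj,
    EinsteinUniverse.exists_isometryEquiv hdet hk hconj⟩
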